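/- Let $M$ be a compact complex manifold with a Kähler metric $\omega=\sqrt{-1}\,g_{\alpha\bar\beta}\,dz^\alpha\wedge d\bar z^\beta$, and let $\pi:\mathcal X\to M$ be a holomorphic fibration, i.e. a proper surjective holomorphic map from a complex manifold $\mathcal X$ whose differential has maximal rank everywhere. Let $L\to\mathcal X$ be a holomorphic line bundle. A smooth Hermitian metric on $L$ is denoted by its local weights $\phi$: $|s|^2=e^{-\phi}$ for a local holomorphic frame $s$ of $L$; the difference of two metrics $\phi-\psi$ is then a smooth function on $\mathcal X$. Let $F^+(L)$ be the set of smooth metrics $\phi$ on $L$ such that $\sqrt{-1}\partial\bar\partial\phi$ is positive on every fibre of $\pi$; it is assumed to be non-empty ($L$ is relatively ample). For $\phi\in F^+(L)$ put, in local holomorphic coordinates $(z;v)=(z^1,\dots,z^m;v^1,\dots,v^n)$ of $\mathcal X$ with $\pi(z;v)=z$, $$tr_\omega c(\phi)=g^{\alpha\bar\beta}\left(\phi_{\alpha\bar\beta}-\phi_{\alpha\bar j}\,\phi^{i\bar j}\,\phi_{i\bar\beta}\right),$$ which is a well-defined real function on $\mathcal X$. Let $\lambda\in\mathbb R$ and $\phi_0\in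 F^+(L)$. A solution of the flow on $[0,T)$, $T\le\infty$, is a family $\phi(t)$, $0\le t<T$, of metrics on $L$, smooth on $\mathcal X\times[0,T)$, such that $$\frac{\partial\phi}{\partial t}=tr_\omega c(\phi)-\lambda,\qquad \phi(t)\in F^+(L),\qquad \phi(0)=\phi_0 .$$ (1) If $\phi$ and $\psi$ are solutions of the flow with the same initial metric $\phi_0$, on $[0,T_1)$ and $[0,T_2)$ respectively, then $\phi(t)=\psi(t)$ for all $0\le t<\min(T_1,T_2)$. (2) There is a constant $C>0$, which depends on the data $(\pi,L,\omega,\lambda,\phi_0)$ but not on $T$ or on the solution, such that every solution $\phi$ on $[0,T)$ satisfies, on $\mathcal X$ and for all $0\le t<T$, $$|tr_\omega c(\phi(t))|<C\qquad\text{and}\qquad|\phi(t)-\phi_0|\le Ct .$$ -/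

import Mathlib

open scoped Manifold ContDiff

noncomputable section

namespace GeodesicFlow

/-! ### The complex Hessian -/

section Levi

variable {E : Type*} [NormedAddCommGroup E] [NormedSpace ℂ E]

/-- The complex Hessian `∑ f_{a b̄} u^a \bar{v^b}` of a real function `f` at `p`, i.e.
`(∂∂̄f)(u^{1,0}, \overline{v^{1,0}})`, written through the real second derivative of `f`.
It is `ℂ`-linear in `u` and conjugate-linear in `v`. -/
def leviForm (f : E → ℝ) (p u v : E) : ℂ :=
  let D : E → E → ℝ := fun a b => fderiv ℝ (fderiv ℝ f) p a b
  (1 / 4 : ℂ) * (((D u v + D (Complex.I • u) (Complex.I • v) : ℝ) : ℂ) +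
    Complex.I * ((D u (Complex.I • v) - D (Complex.I • u) v : ℝ) : ℂ))

end Levi

/-! ### Holomorphic fibrations -/

section Fibration

variable {E F : Type*} [NormedAddCommGroup E] [NormedSpace ℂ E]
  [NormedAddCommGroup F] [NormedSpace ℂ F]
  {X M : Type*} [TopologicalSpace X] [ChartedSpace E X] [TopologicalSpace M] [ChartedSpace F M]

/-- The (complex) differential of `π` at `x`, as a map `T_x X = E → T_{π x} M = F`; the tangent
spaces are identified with the model spaces through the preferred charts. -/
def differential (π : X → M) (x : X) : E →L[ℂ] F := mfderiv 𝓘(ℂ, E) 𝓘(ℂ, F) π x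

variable (E F) in
/-- A proper surjective holomorphic map whose differential has maximal rank everywhere. -/
structure IsHolomorphicFibration (π : X → M) : Prop where
  holomorphic : ContMDiff 𝓘(ℂ, E) 𝓘(ℂ, F) ω π
  surjective : Function.Surjective π
  proper : IsProperMap π
  submersion : ∀ x, Function.Surjective (differential (E := E) (F := F) π x)

/-- The vertical tangent space at `x`: the tangent space of the fibre through `x`. -/
def vertical (π : X → M) (x : X) : Submodule ℂ E :=
  LinearMap.ker (differential (E := E) (F := F) π x).toLinearMap

end Fibration

/-! ### Kähler metrics -/

section Kahler

variable {F : Type*} [NormedAddCommGroup F] [NormedSpace ℂ F]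
  {M : Type*} [TopologicalSpace M] [ChartedSpace F M] [IsManifold 𝓘(ℂ, F) ω M]

/-- The coefficient `g(a, \bar b)`, for constant coordinate vectors `a`, `b`, of a field of
sesquilinear forms on the tangent spaces, in the chart around `y₀`, as a function of the
coordinate `z`. -/
def localCoeff
    (g : ∀ y : M, TangentSpace 𝓘(ℂ, F) y →ₗ[ℂ] TangentSpace 𝓘(ℂ, F) y →ₗ⋆[ℂ] ℂ)
    (y₀ : M) (a b z : F) : ℂ :=
  let y : M := (chartAt F y₀).symm z
  g y (tangentCoordChange 𝓘(ℂ, F) y₀ y y a) (tangentCoordChange 𝓘(ℂ, F) y₀ y y b)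

variable (F M) in
/-- A Kähler metric `ω = √-1 g_{αβ̄} dz^α ∧ dz̄^β`: a smooth field of positive definite Hermitian
forms `g_y(a, b) = g_{αβ̄} a^α \bar{b^β}` whose fundamental form, `ω(a, b) = -2 Im g(a, b)`, is
closed. -/
structure KahlerMetric where
  form : ∀ y : M, TangentSpace 𝓘(ℂ, F) y →ₗ[ℂ] TangentSpace 𝓘(ℂ, F) y →ₗ⋆[ℂ] ℂ
  hermitian : ∀ y a b, form y b a = starRingEnd ℂ (form y a b)
  pos : ∀ y a, a ≠ 0 → 0 < (form y a a).re
  smooth : ∀ (y₀ : M) (a b : F),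
    ContDiffOn ℝ ∞ (localCoeff form y₀ a b) (chartAt F y₀).target
  closed : ∀ (y₀ : M), ∀ z ∈ (chartAt F y₀).target, ∀ a b c : F,
    fderiv ℝ (fun w => -2 * (localCoeff form y₀ b c w).im) z a
      - fderiv ℝ (fun w => -2 * (localCoeff form y₀ a c w).im) z b
      + fderiv ℝ (fun w => -2 * (localCoeff form y₀ a b w).im) z c = 0

end Kahler

/-! ### Metrics on a holomorphic line bundle -/

section LineBundle

variable {E : Type*} [NormedAddCommGroup E] [NormedSpace ℂ E]
  {X : Type*} [TopologicalSpace X] [ChartedSpace E X]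
  {L : X → Type*} [∀ x, AddCommGroup (L x)] [∀ x, Module ℂ (L x)]
  [∀ x, TopologicalSpace (L x)] [TopologicalSpace (Bundle.TotalSpace ℂ L)] [FiberBundle ℂ L]

variable (E L) in
/-- A smooth Hermitian metric on a line bundle `L`, given by the squared length of vectors.
Here `x ↦ e.symm x 1` is the local frame of `L` that belongs to the trivialization `e`. -/
@[ext]
structure LineMetric where
  normSq : ∀ x, L x → ℝ
  smul : ∀ x (c : ℂ) (v : L x), normSq x (c • v) = ‖c‖ ^ 2 * normSq x v
  pos : ∀ x (v : L x), v ≠ 0 → 0 < normSq x v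
  smooth : ∀ (e : Bundle.Trivialization ℂ (Bundle.TotalSpace.proj : Bundle.TotalSpace ℂ L → X))
    [MemTrivializationAtlas e],
    ContMDiffOn 𝓘(ℝ, E) 𝓘(ℝ, ℝ) ∞ (fun x => normSq x (e.symm x 1)) e.baseSet

/-- The local weight of a metric in the frame `s_e` of a trivialization `e`:
`|s_e|^2 = exp (-weight)`. -/
def LineMetric.weight (φ : LineMetric E L)
    (e : Bundle.Trivialization ℂ (Bundle.TotalSpace.proj : Bundle.TotalSpace ℂ L → X))
    (x : X) : ℝ :=
  -Real.log (φ.normSq x (e.symm x 1))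

/-- The global function `φ - ψ`: the difference of the local weights in a common local frame
(any local frame gives the same value). -/
def LineMetric.diff (φ ψ : LineMetric E L) (x : X) : ℝ :=
  φ.weight (trivializationAt ℂ L x) x - ψ.weight (trivializationAt ℂ L x) x

/-- The Hermitian form of `√-1 ∂∂̄φ` on the tangent space `T_x X = E`:
`(u, v) ↦ φ_{a b̄} u^a \bar{v^b}`, computed in the preferred chart at `x` from the weight of `φ` in
a local holomorphic frame. -/
def LineMetric.curvature (φ : LineMetric E L) (x : X) (u v : E) : ℂ :=
  leviForm (fun z => φ.weight (trivializationAt ℂ L x) ((chartAt E x).symm z)) (chartAt E x x) u v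

end LineBundle

/-! ### Geodesic curvature and the flow -/

section Flow

variable {E F : Type*} [NormedAddCommGroup E] [NormedSpace ℂ E] [FiniteDimensional ℂ E]
  [NormedAddCommGroup F] [NormedSpace ℂ F] [FiniteDimensional ℂ F]
  {X M : Type*} [TopologicalSpace X] [ChartedSpace E X] [TopologicalSpace M] [ChartedSpace F M]
  {L : X → Type*} [∀ x, AddCommGroup (L x)] [∀ x, Module ℂ (L x)]
  [∀ x, TopologicalSpace (L x)] [TopologicalSpace (Bundle.TotalSpace ℂ L)] [FiberBundle ℂ L]

/-- `F⁺(L)`: the smooth metrics `φ` on `L` such that `√-1 ∂∂̄φ` is positive on every fibre. -/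
def FPlus (π : X → M) : Set (LineMetric E L) :=
  {φ | ∀ x, ∀ v ∈ vertical (E := E) (F := F) π x, v ≠ 0 → 0 < (φ.curvature x v v).re}

/-- The geodesic curvature `c(φ)`, a Hermitian form on `T_x X = E`:
`c(φ)(u, w) = φ(u, w̄) - φ(u, v̄_j) φ^{i j̄} φ(v_i, w̄)`, where `(v_i)` is a basis of the vertical
space and `φ^{i j̄}` is the inverse of `φ_{i j̄} = φ(v_i, v̄_j)`, i.e. `φ_{k j̄} φ^{i j̄} = δ_{ki}`.
(It does not depend on the basis and vanishes when `u` or `w` is vertical, so that in admissible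
coordinates `(z; v)` it is `(φ_{αβ̄} - φ_{αj̄} φ^{ij̄} φ_{iβ̄}) dz^α ⊗ dz̄^β`.) -/
def geodesicCurvature (π : X → M) (φ : LineMetric E L) (x : X) (u w : E) : ℂ :=
  let v := Module.finBasis ℂ (vertical (E := E) (F := F) π x)
  let D : Matrix _ _ ℂ := Matrix.of fun k j => φ.curvature x (v k : E) (v j : E)
  φ.curvature x u w -
    ∑ i, ∑ j, φ.curvature x u (v j : E) * D⁻¹ j i * φ.curvature x (v i : E) w

variable [IsManifold 𝓘(ℂ, F) ω M]

/-- `tr_ω c(φ) = g^{αβ̄} c(φ)_{αβ̄}`: here `(e_α)` is a basis of `T_{π x} M = F`,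
`g_{αβ̄} = g(e_α, ē_β)`, `g^{αβ̄}` is the inverse matrix (`g_{γβ̄} g^{αβ̄} = δ_{γα}`), and
`c(φ)_{αβ̄}` is the value of `c(φ)` on lifts of `e_α`, `e_β` to `T_x X` (any lifts give the same
value, because `c(φ)` vanishes on vertical vectors). -/
def trGeodesicCurvature (π : X → M) (g : KahlerMetric F M) (φ : LineMetric E L) (x : X) : ℝ :=
  let e := Module.finBasis ℂ F
  let lift : Fin (Module.finrank ℂ F) → E := fun α =>
    Function.invFun (differential (E := E) (F := F) π x) (e α)
  let G : Matrix _ _ ℂ := Matrix.of fun α β => g.form (π x) (e α) (e β)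
  let c : Matrix _ _ ℂ := Matrix.of fun α β =>
    geodesicCurvature (F := F) π φ x (lift α) (lift β)
  (∑ α, ∑ β, G⁻¹ β α * c α β).re

/-- The interval `[0, T)`, where `T ≤ ∞`. -/
def timeInterval (T : EReal) : Set ℝ := {t | 0 ≤ t ∧ (t : EReal) < T}

/-- `φ` is a (smooth) solution on `X × [0, T)` of the flow `∂φ/∂t = tr_ω c(φ) - lam`, `φ ∈ F⁺(L)`,
`φ(0) = φ₀`. The values of `φ` at times outside `[0, T)` play no role. -/
structure IsFlowSolution (π : X → M) (g : KahlerMetric F M) (lam : ℝ) (φ₀ : LineMetric E L)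
    (T : EReal) (φ : ℝ → LineMetric E L) : Prop where
  smooth : ∀ (e : Bundle.Trivialization ℂ
      (Bundle.TotalSpace.proj : Bundle.TotalSpace ℂ L → X)) [MemTrivializationAtlas e],
    ContMDiffOn (𝓘(ℝ, E).prod 𝓘(ℝ, ℝ)) 𝓘(ℝ, ℝ) ∞
      (fun p : X × ℝ => (φ p.2).weight e p.1) (e.baseSet ×ˢ timeInterval T)
  mem_FPlus : ∀ t ∈ timeInterval T, φ t ∈ FPlus (F := F) π
  equation : ∀ t ∈ timeInterval T, ∀ x : X,
    HasDerivWithinAt (fun s => (φ s).weight (trivializationAt ℂ L x) x)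
      (trGeodesicCurvature π g (φ t) x - lam) (timeInterval T) t
  initial : φ 0 = φ₀

end Flow

end GeodesicFlow

end

/-!
The geodesic curvature `c(φ)` is the Schur complement of the complex Hessian of the weight of `φ`
with respect to the vertical space. Its value on `u` is the minimum of the Hessian over all `u + v`
with `v` vertical, so it is monotone in the Hessian. At a maximum of `φ - ψ` the Hessian of `φ` is
at most that of `ψ`, hence `tr_ω c(φ) ≤ tr_ω c(ψ)` there: the flow is degenerate elliptic.

By the parabolic maximum principle on the compact manifold `X`, any two solutions then satisfy
`sup |φ(t) - ψ(t)| ≤ sup |φ(0) - ψ(0)|`, which contains uniqueness. If `K` bounds the initial speed,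
the barriers `φ₀ ± K t` give `|φ(t) - φ₀| ≤ K t`. Time translates of a solution are solutions,
so `|φ(t + h) - φ(t)| ≤ sup |φ(h) - φ₀| ≤ K h`, and the speed is bounded by `K` at all times.
-/

noncomputable section

namespace GeodesicFlow

section HermitianForm

open scoped ComplexOrder Matrix

variable {𝕜 E ι : Type*} [RCLike 𝕜] [AddCommGroup E] [Module 𝕜 E]

/-- A sesquilinear form is Hermitian if exchanging its arguments conjugates its value. -/
def IsHermitianForm (B : E →ₗ[𝕜] E →ₗ⋆[𝕜] 𝕜) : Prop :=
  ∀ u v, B v u = starRingEnd 𝕜 (B u v)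

/-- Positive definiteness of a sesquilinear form on a subspace. -/
def IsPositiveOn (B : E →ₗ[𝕜] E →ₗ⋆[𝕜] 𝕜) (V : Submodule 𝕜 E) : Prop :=
  ∀ u ∈ V, u ≠ 0 → 0 < RCLike.re (B u u)

/-- The Gram matrix of a family of vectors with respect to a sesquilinear form, which need not be
an inner product. -/
def gramMatrix (B : E →ₗ[𝕜] E →ₗ⋆[𝕜] 𝕜) (v : ι → E) : Matrix ι ι 𝕜 :=
  Matrix.of fun i j => B (v i) (v j)

variable {B C : E →ₗ[𝕜] E →ₗ⋆[𝕜] 𝕜} {V : Submodule 𝕜 E}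

theorem IsHermitianForm.sub (hB : IsHermitianForm B) (hC : IsHermitianForm C) :
    IsHermitianForm (B - C) := fun u v => by
  simp only [LinearMap.sub_apply, map_sub, hB u v, hC u v]

theorem IsHermitianForm.apply_self_eq_re (hB : IsHermitianForm B) (u : E) :
    B u u = (RCLike.re (B u u) : 𝕜) :=
  (RCLike.conj_eq_iff_re.mp (hB u u).symm).symm

theorem IsPositiveOn.re_apply_self_nonneg (hB : IsPositiveOn B V) {u : E} (hu : u ∈ V) :
    0 ≤ RCLike.re (B u u) := by
  rcases eq_or_ne u 0 with rfl | hu0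
  · simp
  · exact (hB u hu hu0).le

theorem IsHermitianForm.isHermitian_gramMatrix (hB : IsHermitianForm B) (v : ι → E) :
    (gramMatrix B v).IsHermitian := by
  ext i j
  exact (hB (v j) (v i)).symm

theorem star_dotProduct_gramMatrix_mulVec [Fintype ι] (B : E →ₗ[𝕜] E →ₗ⋆[𝕜] 𝕜) (v : ι → E)
    (x : ι → 𝕜) :
    star x ⬝ᵥ (gramMatrix B v *ᵥ x) = B (∑ i, star (x i) • v i) (∑ i, star (x i) • v i) := by
  simp only [dotProduct, Matrix.mulVec, gramMatrix, Matrix.of_apply, Pi.star_apply, map_sum,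
    map_smulₛₗ, LinearMap.sum_apply, LinearMap.smul_apply, Finset.mul_sum,
    smul_eq_mul, RingHom.id_apply, starRingEnd_apply, star_star]
  rw [Finset.sum_comm]
  exact Finset.sum_congr rfl fun i _ => Finset.sum_congr rfl fun j _ => by ring

theorem IsHermitianForm.posDef_gramMatrix [Finite ι] (hB : IsHermitianForm B) {v : ι → E}
    (hv : LinearIndependent 𝕜 v) (hpos : IsPositiveOn B (Submodule.span 𝕜 (Set.range v))) :
    (gramMatrix B v).PosDef := by
  have := Fintype.ofFinite ι
  refine .of_dotProduct_mulVec_pos (hB.isHermitian_gramMatrix v) fun x hx => ?_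
  rw [star_dotProduct_gramMatrix_mulVec, hB.apply_self_eq_re, RCLike.ofReal_pos]
  refine hpos _ (Submodule.sum_mem _ fun i _ =>
    Submodule.smul_mem _ _ (Submodule.subset_span ⟨i, rfl⟩)) fun hsum => hx ?_
  ext i
  simpa using Fintype.linearIndependent_iff.mp hv (fun i => star (x i)) hsum i

theorem IsHermitianForm.posSemidef_gramMatrix [Finite ι] (hB : IsHermitianForm B)
    (hnonneg : ∀ u, 0 ≤ RCLike.re (B u u)) (v : ι → E) : (gramMatrix B v).PosSemidef := by
  have := Fintype.ofFinite ι
  refine .of_dotProduct_mulVec_nonneg (hB.isHermitian_gramMatrix v) fun x => ?_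
  rw [star_dotProduct_gramMatrix_mulVec, hB.apply_self_eq_re, RCLike.ofReal_nonneg]
  exact hnonneg _

theorem trace_mul_nonneg_of_posSemidef [Fintype ι] {P Q : Matrix ι ι 𝕜} (hP : P.PosSemidef)
    (hQ : Q.PosSemidef) : 0 ≤ (P * Q).trace := by
  classical
  open scoped MatrixOrder in
  obtain ⟨S, rfl⟩ := CStarAlgebra.nonneg_iff_eq_star_mul_self.mp hP.nonneg
  rw [Matrix.mul_assoc, Matrix.trace_mul_comm]
  exact (hQ.mul_mul_conjTranspose_same S).trace_nonneg

theorem re_trace_mul_gramMatrix_mono [Fintype ι] (hB : IsHermitianForm B) (hC : IsHermitianForm C)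
    (hBC : ∀ u, RCLike.re (B u u) ≤ RCLike.re (C u u)) {P : Matrix ι ι 𝕜} (hP : P.PosSemidef)
    (v : ι → E) :
    RCLike.re (P * gramMatrix B v).trace ≤ RCLike.re (P * gramMatrix C v).trace := by
  have hgram : gramMatrix (C - B) v = gramMatrix C v - gramMatrix B v := rfl
  have hpsd : (gramMatrix (C - B) v).PosSemidef :=
    (hC.sub hB).posSemidef_gramMatrix (fun u => by simpa using hBC u) v
  have htrace := (RCLike.nonneg_iff.mp (trace_mul_nonneg_of_posSemidef hP hpsd)).1
  rwa [hgram, Matrix.mul_sub, Matrix.trace_sub, map_sub, sub_nonneg] at htrace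

theorem IsHermitianForm.posDef_gramMatrix_basis [Finite ι] (hB : IsHermitianForm B)
    (hpos : IsPositiveOn B V) (b : Module.Basis ι 𝕜 V) :
    (gramMatrix B fun i => (b i : E)).PosDef := by
  refine hB.posDef_gramMatrix (b.linearIndependent.map' V.subtype V.ker_subtype)
    fun u hu => hpos u ?_
  refine Submodule.span_le.mpr ?_ hu
  rintro _ ⟨i, rfl⟩
  exact (b i).2

section Schur

variable [Fintype ι] [DecidableEq ι]

/-- The component of a vector orthogonal to a subspace with basis `b`, with respect to a form whose
Gram matrix in this basis is invertible. (Otherwise the inverse matrix is `0`, and the map is the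
identity.) -/
def orthogonalPart (B : E →ₗ[𝕜] E →ₗ⋆[𝕜] 𝕜) (b : Module.Basis ι 𝕜 V) : E →ₗ[𝕜] E :=
  LinearMap.id - ∑ i, (∑ j, (gramMatrix B fun i => (b i : E))⁻¹ j i •
    B.flip (b j : E)).smulRight (b i : E)

/-- The Schur complement of a sesquilinear form with respect to a subspace with basis `b`. -/
def schurComplement (B : E →ₗ[𝕜] E →ₗ⋆[𝕜] 𝕜) (b : Module.Basis ι 𝕜 V) : E →ₗ[𝕜] E →ₗ⋆[𝕜] 𝕜 :=
  B ∘ₗ orthogonalPart B b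

theorem orthogonalPart_apply (B : E →ₗ[𝕜] E →ₗ⋆[𝕜] 𝕜) (b : Module.Basis ι 𝕜 V) (u : E) :
    orthogonalPart B b u =
      u - ∑ i, (∑ j, B u (b j) * (gramMatrix B fun i => (b i : E))⁻¹ j i) • (b i : E) := by
  simp [orthogonalPart, LinearMap.sum_apply, mul_comm]

theorem sub_orthogonalPart_mem (B : E →ₗ[𝕜] E →ₗ⋆[𝕜] 𝕜) (b : Module.Basis ι 𝕜 V) (u : E) :
    u - orthogonalPart B b u ∈ V := by
  rw [orthogonalPart_apply, sub_sub_cancel]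
  exact V.sum_mem fun i _ => V.smul_mem _ (b i).2

theorem schurComplement_apply (B : E →ₗ[𝕜] E →ₗ⋆[𝕜] 𝕜) (b : Module.Basis ι 𝕜 V) (u w : E) :
    schurComplement B b u w = B u w -
      ∑ i, ∑ j, B u (b j) * (gramMatrix B fun i => (b i : E))⁻¹ j i * B (b i) w := by
  simp [schurComplement, orthogonalPart_apply, LinearMap.sum_apply, Finset.sum_mul]

variable {b : Module.Basis ι 𝕜 V}

theorem schurComplement_apply_basis (hb : IsUnit (gramMatrix B fun i => (b i : E)))
    (u : E) (k : ι) : schurComplement B b u (b k) = 0 := by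
  set D := gramMatrix B fun i => (b i : E)
  have hinv : ∀ j, ∑ i, D⁻¹ j i * B (b i) (b k) = (1 : Matrix ι ι 𝕜) j k := fun j => by
    rw [← Matrix.nonsing_inv_mul D ((Matrix.isUnit_iff_isUnit_det D).mp hb)]
    rfl
  rw [schurComplement_apply, Finset.sum_comm, sub_eq_zero]
  simp only [mul_assoc, ← Finset.mul_sum]
  simp [D, hinv, Matrix.one_apply]

theorem apply_orthogonalPart_of_mem (hb : IsUnit (gramMatrix B fun i => (b i : E))) (u : E)
    {w : E} (hw : w ∈ V) : B (orthogonalPart B b u) w = 0 := by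
  have hzero : (B (orthogonalPart B b u)).comp V.subtype = 0 :=
    b.ext fun k => schurComplement_apply_basis hb u k
  exact DFunLike.congr_fun hzero ⟨w, hw⟩

theorem schurComplement_apply_eq (hb : IsUnit (gramMatrix B fun i => (b i : E))) (u w : E) :
    schurComplement B b u w = B (orthogonalPart B b u) (orthogonalPart B b w) := by
  have horth := apply_orthogonalPart_of_mem hb u (sub_orthogonalPart_mem B b w)
  rwa [map_sub, sub_eq_zero] at horth

theorem IsHermitianForm.isHermitianForm_schurComplement (hB : IsHermitianForm B)
    (hb : IsUnit (gramMatrix B fun i => (b i : E))) : IsHermitianForm (schurComplement B b) :=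
  fun u v => by rw [schurComplement_apply_eq hb, schurComplement_apply_eq hb, hB]

theorem re_schurComplement_self_le (hB : IsHermitianForm B) (hpos : IsPositiveOn B V) {u w : E}
    (huw : u - w ∈ V) :
    RCLike.re (schurComplement B b u u) ≤ RCLike.re (B w w) := by
  have hb := (hB.posDef_gramMatrix_basis hpos b).isUnit
  set p := orthogonalPart B b u
  have hd : w - p ∈ V := by
    have := V.sub_mem (sub_orthogonalPart_mem B b u) huw
    rwa [sub_sub_sub_cancel_left] at this
  have horth : B p (w - p) = 0 := apply_orthogonalPart_of_mem hb u hd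
  have horth' : B (w - p) p = 0 := by rw [hB p, horth, map_zero]
  have pythagoras : B w w = B p p + B (w - p) (w - p) := by
    conv_lhs => rw [← add_sub_cancel p w]
    simp only [map_add, LinearMap.add_apply, horth, horth', add_zero, zero_add]
  rw [schurComplement_apply_eq hb, pythagoras, map_add]
  exact le_add_of_nonneg_right (hpos.re_apply_self_nonneg hd)

theorem re_schurComplement_self_mono (hB : IsHermitianForm B) (hC : IsHermitianForm C)
    (hBpos : IsPositiveOn B V) (hCpos : IsPositiveOn C V)
    (hBC : ∀ u, RCLike.re (B u u) ≤ RCLike.re (C u u)) (u : E) :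
    RCLike.re (schurComplement B b u u) ≤ RCLike.re (schurComplement C b u u) := by
  rw [schurComplement_apply_eq (hC.posDef_gramMatrix_basis hCpos b).isUnit]
  exact (re_schurComplement_self_le hB hBpos (sub_orthogonalPart_mem C b u)).trans (hBC _)

end Schur

end HermitianForm

section SecondDerivative

open Filter Topology

theorem deriv_deriv_nonpos_of_isLocalMax {f : ℝ → ℝ} {a : ℝ} (h : IsLocalMax f a)
    (hf : ContinuousAt f a) : deriv (deriv f) a ≤ 0 := by
  by_contra! hpos
  have hmin : IsLocalMin f a := isLocalMin_of_deriv_deriv_pos hpos h.deriv_eq_zero hf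
  have hconst : f =ᶠ[𝓝 a] fun _ => f a := by
    filter_upwards [h, hmin] with x hle hge using le_antisymm hle hge
  have hzero : deriv (deriv f) a = 0 := by
    rw [hconst.deriv.deriv_eq]
    simp
  exact hpos.ne' hzero

variable {E : Type*} [NormedAddCommGroup E] [NormedSpace ℝ E] {f g : E → ℝ} {p : E}

theorem tendsto_add_smul_nhds_zero (p u : E) :
    Tendsto (fun s : ℝ => p + s • u) (𝓝 0) (𝓝 p) :=
  Continuous.tendsto' (by fun_prop) 0 p (by simp)

theorem deriv_deriv_comp_add_smul (hf : ContDiffAt ℝ 2 f p) (u : E) :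
    deriv (deriv fun s : ℝ => f (p + s • u)) 0 = fderiv ℝ (fderiv ℝ f) p u u := by
  have hline : ∀ t : ℝ, HasDerivAt (fun s : ℝ => p + s • u) u t := fun t => by
    simpa using ((hasDerivAt_id t).smul_const u).const_add p
  have hfirst : deriv (fun s : ℝ => f (p + s • u)) =ᶠ[𝓝 0] fun s => fderiv ℝ f (p + s • u) u := by
    filter_upwards [(tendsto_add_smul_nhds_zero p u).eventually (hf.eventually (by simp))] with s hs
    exact ((hs.differentiableAt (by simp)).hasFDerivAt.comp_hasDerivAt s (hline s)).deriv
  have hsecond : HasFDerivAt (fderiv ℝ f) (fderiv ℝ (fderiv ℝ f) p) (p + (0 : ℝ) • u) := by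
    rw [zero_smul, add_zero]
    exact ((hf.fderiv_right (m := 1) (by norm_num)).differentiableAt one_ne_zero).hasFDerivAt
  rw [hfirst.deriv_eq]
  exact ((ContinuousLinearMap.apply ℝ ℝ u).hasFDerivAt.comp_hasDerivAt (0 : ℝ)
    (hsecond.comp_hasDerivAt (0 : ℝ) (hline 0))).deriv

theorem fderiv_fderiv_apply_self_nonpos_of_isLocalMax (h : IsLocalMax f p)
    (hf : ContDiffAt ℝ 2 f p) (u : E) : fderiv ℝ (fderiv ℝ f) p u u ≤ 0 := by
  rw [← deriv_deriv_comp_add_smul hf u]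
  refine deriv_deriv_nonpos_of_isLocalMax ?_ ?_
  · simpa [IsLocalMax, IsMaxFilter] using (tendsto_add_smul_nhds_zero p u).eventually h
  · exact hf.continuousAt.comp_of_eq (by fun_prop) (by simp)

theorem fderiv_fderiv_sub (hf : ContDiffAt ℝ 2 f p) (hg : ContDiffAt ℝ 2 g p) :
    fderiv ℝ (fderiv ℝ (f - g)) p = fderiv ℝ (fderiv ℝ f) p - fderiv ℝ (fderiv ℝ g) p := by
  have hdiff : ∀ {k : E → ℝ}, ContDiffAt ℝ 2 k p → DifferentiableAt ℝ (fderiv ℝ k) p := fun hk =>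
    (hk.fderiv_right (m := 1) (by norm_num)).differentiableAt one_ne_zero
  have hfirst : fderiv ℝ (f - g) =ᶠ[𝓝 p] fderiv ℝ f - fderiv ℝ g := by
    filter_upwards [hf.eventually (by simp), hg.eventually (by simp)] with z hfz hgz
    exact fderiv_sub (hfz.differentiableAt (by simp)) (hgz.differentiableAt (by simp))
  rw [hfirst.fderiv_eq, fderiv_sub (hdiff hf) (hdiff hg)]

end SecondDerivative

section LeviForm

variable {E : Type*} [NormedAddCommGroup E] [NormedSpace ℂ E] {f g : E → ℝ} {p : E}

theorem smul_eq_re_smul_add_im_smul (c : ℂ) (u : E) :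
    c • u = c.re • u + c.im • Complex.I • u := by
  rw [← Complex.coe_smul, ← Complex.coe_smul, smul_smul, ← add_smul, Complex.re_add_im]

theorem I_smul_I_smul (u : E) : Complex.I • Complex.I • u = -u := by
  rw [smul_smul, Complex.I_mul_I, neg_one_smul]

theorem leviForm_add_left (f : E → ℝ) (p u u' v : E) :
    leviForm f p (u + u') v = leviForm f p u v + leviForm f p u' v := by
  simp only [leviForm, smul_add, map_add, add_apply]
  push_cast
  ring

theorem leviForm_add_right (f : E → ℝ) (p u v v' : E) :
    leviForm f p u (v + v') = leviForm f p u v + leviForm f p u v' := by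
  simp only [leviForm, smul_add, map_add]
  push_cast
  ring

theorem leviForm_real_smul_left (f : E → ℝ) (p : E) (r : ℝ) (u v : E) :
    leviForm f p (r • u) v = r * leviForm f p u v := by
  simp only [leviForm, smul_comm Complex.I r, map_smul, smul_apply, smul_eq_mul]
  push_cast
  ring

theorem leviForm_real_smul_right (f : E → ℝ) (p : E) (r : ℝ) (u v : E) :
    leviForm f p u (r • v) = r * leviForm f p u v := by
  simp only [leviForm, smul_comm Complex.I r, map_smul, smul_eq_mul]
  push_cast
  ring

theorem leviForm_I_smul_left (f : E → ℝ) (p u v : E) :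
    leviForm f p (Complex.I • u) v = Complex.I * leviForm f p u v := by
  simp only [leviForm, I_smul_I_smul, map_neg, neg_apply]
  push_cast
  linear_combination (-1 / 4 * (fderiv ℝ (fderiv ℝ f) p u (Complex.I • v) -
    fderiv ℝ (fderiv ℝ f) p (Complex.I • u) v : ℂ)) * Complex.I_sq

theorem leviForm_I_smul_right (f : E → ℝ) (p u v : E) :
    leviForm f p u (Complex.I • v) = -Complex.I * leviForm f p u v := by
  simp only [leviForm, I_smul_I_smul, map_neg]
  push_cast
  linear_combination (1 / 4 * (fderiv ℝ (fderiv ℝ f) p u (Complex.I • v) -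
    fderiv ℝ (fderiv ℝ f) p (Complex.I • u) v : ℂ)) * Complex.I_sq

theorem leviForm_smul_left (f : E → ℝ) (p : E) (c : ℂ) (u v : E) :
    leviForm f p (c • u) v = c * leviForm f p u v := by
  rw [smul_eq_re_smul_add_im_smul, leviForm_add_left, leviForm_real_smul_left,
    leviForm_real_smul_left, leviForm_I_smul_left, ← mul_assoc, ← add_mul, Complex.re_add_im]

theorem leviForm_smul_right (f : E → ℝ) (p : E) (c : ℂ) (u v : E) :
    leviForm f p u (c • v) = starRingEnd ℂ c * leviForm f p u v := by
  have hconj : starRingEnd ℂ c = c.re + c.im * -Complex.I := by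
    apply Complex.ext <;> simp
  rw [smul_eq_re_smul_add_im_smul, leviForm_add_right, leviForm_real_smul_right,
    leviForm_real_smul_right, leviForm_I_smul_right, hconj, add_mul, mul_assoc]

/-- The complex Hessian `leviForm f p` as a bundled sesquilinear form. -/
def leviSesquilinear (f : E → ℝ) (p : E) : E →ₗ[ℂ] E →ₗ⋆[ℂ] ℂ :=
  LinearMap.mk₂'ₛₗ (RingHom.id ℂ) (starRingEnd ℂ) (leviForm f p) (leviForm_add_left f p)
    (leviForm_smul_left f p) (leviForm_add_right f p) (leviForm_smul_right f p)

theorem isHermitianForm_leviSesquilinear (hf : ContDiffAt ℝ 2 f p) :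
    IsHermitianForm (leviSesquilinear f p) := fun u v => by
  have hsymm : ∀ a b, fderiv ℝ (fderiv ℝ f) p a b = fderiv ℝ (fderiv ℝ f) p b a :=
    hf.isSymmSndFDerivAt (by simp)
  simp only [leviSesquilinear, LinearMap.mk₂'ₛₗ_apply, leviForm, hsymm v, hsymm (Complex.I • v)]
  apply Complex.ext <;> simp

theorem re_leviForm_self (f : E → ℝ) (p u : E) :
    (leviForm f p u u).re = (fderiv ℝ (fderiv ℝ f) p u u +
      fderiv ℝ (fderiv ℝ f) p (Complex.I • u) (Complex.I • u)) / 4 := by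
  simp only [leviForm, Complex.mul_re, Complex.add_re, Complex.I_re, Complex.I_im,
    Complex.ofReal_re, Complex.ofReal_im]
  norm_num
  ring

theorem re_leviForm_self_le_of_isLocalMax_sub (hf : ContDiffAt ℝ 2 f p) (hg : ContDiffAt ℝ 2 g p)
    (h : IsLocalMax (f - g) p) (u : E) :
    (leviForm f p u u).re ≤ (leviForm g p u u).re := by
  have hhess : ∀ w, fderiv ℝ (fderiv ℝ f) p w w ≤ fderiv ℝ (fderiv ℝ g) p w w := fun w => by
    have := fderiv_fderiv_apply_self_nonpos_of_isLocalMax h (hf.sub hg) w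
    rwa [fderiv_fderiv_sub hf hg, sub_apply, sub_apply, sub_nonpos] at this
  rw [re_leviForm_self, re_leviForm_self]
  gcongr
  exacts [hhess u, hhess _]

end LeviForm

section MaximumPrinciple

open Filter Topology Set

theorem nonneg_of_hasDerivWithinAt_of_isMaxOn_right {f : ℝ → ℝ} {f' a b : ℝ} (hab : a < b)
    (hf : HasDerivWithinAt f f' (Icc a b) b) (hmax : IsMaxOn f (Icc a b) b) : 0 ≤ f' := by
  have hcone : a - b ∈ posTangentConeAt (Icc a b) b :=
    sub_mem_posTangentConeAt_of_segment_subset (by rw [segment_symm, segment_eq_Icc hab.le])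
  have hslope : (a - b) * f' ≤ 0 := by
    simpa using hmax.localize.hasFDerivWithinAt_nonpos hf.hasFDerivWithinAt hcone
  exact nonneg_of_mul_nonpos_right hslope (sub_neg.mpr hab)

theorem abs_le_of_hasDerivWithinAt_of_forall_abs_sub_le {f : ℝ → ℝ} {f' t C : ℝ} {s : Set ℝ}
    (hf : HasDerivWithinAt f f' s t) (hs : UniqueDiffWithinAt ℝ s t)
    (hC : ∀ u ∈ s, |f u - f t| ≤ C * |u - t|) : |f'| ≤ C := by
  have : (𝓝[s \ {t}] t).NeBot := by
    rwa [← accPt_principal_iff_nhdsWithin, ← uniqueDiffWithinAt_iff_accPt]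
  refine le_of_tendsto (hasDerivWithinAt_iff_tendsto_slope.mp hf).abs ?_
  filter_upwards [self_mem_nhdsWithin] with u hu
  rw [slope_def_field, abs_div, div_le_iff₀ (abs_pos.mpr (sub_ne_zero.mpr hu.2))]
  exact hC u hu.1

variable {X : Type*} [TopologicalSpace X] [CompactSpace X] {f f' : X → ℝ → ℝ} {a b m K : ℝ}

theorem le_add_mul_of_deriv_lt_at_max
    (hcont : ContinuousOn (fun p : X × ℝ => f p.1 p.2) (univ ×ˢ Icc a b))
    (hderiv : ∀ t ∈ Icc a b, ∀ x, HasDerivWithinAt (f x) (f' x t) (Icc a b) t)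
    (hinit : ∀ x, f x a ≤ m)
    (hmax : ∀ t ∈ Icc a b, ∀ x, IsMaxOn (fun y => f y t) univ x → f' x t < K)
    {t : ℝ} (ht : t ∈ Icc a b) (x : X) : f x t ≤ m + K * (t - a) := by
  obtain ⟨⟨x₀, t₀⟩, ⟨-, ht₀⟩, hmax₀⟩ := (isCompact_univ.prod isCompact_Icc).exists_isMaxOn
    (f := fun p : X × ℝ => f p.1 p.2 - K * (p.2 - a)) ⟨(x, t), mem_univ _, ht⟩
    (hcont.sub (by fun_prop))
  have hle : ∀ y, ∀ s ∈ Icc a b, f y s - K * (s - a) ≤ f x₀ t₀ - K * (t₀ - a) :=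
    fun y s hs => hmax₀ (show (y, s) ∈ univ ×ˢ Icc a b from ⟨mem_univ _, hs⟩)
  rcases ht₀.1.eq_or_lt with rfl | hpos
  · linarith [hle x t ht, hinit x₀]
  · have hspace : f' x₀ t₀ < K := hmax t₀ ht₀ x₀ fun y _ => by
      simpa using hle y t₀ ht₀
    have hderiv₀ : HasDerivWithinAt (fun s => f x₀ s - K * (s - a)) (f' x₀ t₀ - K)
        (Icc a t₀) t₀ := by
      simpa using ((hderiv t₀ ht₀ x₀).mono (Icc_subset_Icc_right ht₀.2)).fun_sub
        (((hasDerivWithinAt_id t₀ _).sub_const a).const_mul K)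
    have htime : 0 ≤ f' x₀ t₀ - K := nonneg_of_hasDerivWithinAt_of_isMaxOn_right hpos hderiv₀
      fun s hs => hle x₀ s ⟨hs.1, hs.2.trans ht₀.2⟩
    linarith

theorem le_add_mul_of_deriv_le_at_max
    (hcont : ContinuousOn (fun p : X × ℝ => f p.1 p.2) (univ ×ˢ Icc a b))
    (hderiv : ∀ t ∈ Icc a b, ∀ x, HasDerivWithinAt (f x) (f' x t) (Icc a b) t)
    (hinit : ∀ x, f x a ≤ m)
    (hmax : ∀ t ∈ Icc a b, ∀ x, IsMaxOn (fun y => f y t) univ x → f' x t ≤ K)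
    {t : ℝ} (ht : t ∈ Icc a b) (x : X) : f x t ≤ m + K * (t - a) := by
  have hlim : Tendsto (fun K' => m + K' * (t - a)) (𝓝[>] K) (𝓝 (m + K * (t - a))) :=
    (Continuous.tendsto (by fun_prop) K).mono_left nhdsWithin_le_nhds
  refine ge_of_tendsto hlim ?_
  filter_upwards [self_mem_nhdsWithin] with K' hK'
  exact le_add_mul_of_deriv_lt_at_max hcont hderiv hinit
    (fun s hs y hy => (hmax s hs y hy).trans_lt hK') ht x

theorem abs_le_add_mul_of_abs_deriv_le_at_extr
    (hcont : ContinuousOn (fun p : X × ℝ => f p.1 p.2) (univ ×ˢ Icc a b))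
    (hderiv : ∀ t ∈ Icc a b, ∀ x, HasDerivWithinAt (f x) (f' x t) (Icc a b) t)
    (hinit : ∀ x, |f x a| ≤ m)
    (hmax : ∀ t ∈ Icc a b, ∀ x, IsMaxOn (fun y => f y t) univ x → f' x t ≤ K)
    (hmin : ∀ t ∈ Icc a b, ∀ x, IsMinOn (fun y => f y t) univ x → -K ≤ f' x t)
    {t : ℝ} (ht : t ∈ Icc a b) (x : X) : |f x t| ≤ m + K * (t - a) := by
  refine abs_le'.mpr ⟨le_add_mul_of_deriv_le_at_max hcont hderiv
    (fun y => (le_abs_self _).trans (hinit y)) hmax ht x, ?_⟩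
  refine le_add_mul_of_deriv_le_at_max (f := fun y s => -f y s) (f' := fun y s => -f' y s)
    hcont.neg (fun s hs y => (hderiv s hs y).fun_neg)
    (fun y => (neg_le_abs _).trans (hinit y)) (fun s hs y hy => ?_) ht x
  exact neg_le.mp (hmin s hs y (by simpa only [neg_neg] using hy.neg))

end MaximumPrinciple

section DegenerateEllipticFlow

open Set

variable {Φ X : Type*} {w A : Φ → X → ℝ} {S : Set Φ} {I J : Set ℝ} {φ ψ : ℝ → Φ}

/-- An operator `A` on a set `S` of objects `φ` with scalar representatives `w φ` is degenerate
elliptic if it respects the order at points where one representative touches another, up to a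
constant, from below. -/
def IsDegenerateElliptic (w A : Φ → X → ℝ) (S : Set Φ) : Prop :=
  ∀ φ ∈ S, ∀ ψ ∈ S, ∀ x, IsMaxOn (fun y => w φ y - w ψ y) univ x → A φ x ≤ A ψ x

variable [TopologicalSpace X]

/-- `φ` is a solution of `∂ (w φ) / ∂ t = A φ` on the set `I` of times, with values in `S`; the
regularity in space is only continuity, since `A` is an arbitrary operator. -/
structure IsFlowOn (w A : Φ → X → ℝ) (S : Set Φ) (I : Set ℝ) (φ : ℝ → Φ) : Prop where
  continuousOn : ContinuousOn (fun p : X × ℝ => w (φ p.2) p.1) (univ ×ˢ I)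
  mem : ∀ t ∈ I, φ t ∈ S
  hasDerivWithinAt : ∀ t ∈ I, ∀ x, HasDerivWithinAt (fun s => w (φ s) x) (A (φ t) x) I t

theorem IsFlowOn.comp_add_const (hφ : IsFlowOn w A S I φ) {h : ℝ} (hJ : MapsTo (· + h) J I) :
    IsFlowOn w A S J (fun t => φ (t + h)) where
  continuousOn := hφ.continuousOn.comp (f := fun p : X × ℝ => (p.1, p.2 + h)) (by fun_prop)
    fun p hp => ⟨mem_univ _, hJ hp.2⟩
  mem t ht := hφ.mem _ (hJ ht)
  hasDerivWithinAt t ht x := by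
    simpa [Function.comp_def] using (hφ.hasDerivWithinAt _ (hJ ht) x).comp t
      ((hasDerivWithinAt_id t J).add_const h) hJ

theorem IsFlowOn.mono (hφ : IsFlowOn w A S I φ) (hJ : J ⊆ I) : IsFlowOn w A S J φ := by
  simpa using hφ.comp_add_const (h := 0) (fun t ht => by simpa using hJ ht)

variable [CompactSpace X] {a b m K : ℝ}

theorem IsDegenerateElliptic.abs_sub_le_of_abs_sub_le (hA : IsDegenerateElliptic w A S)
    (hφ : IsFlowOn w A S (Icc a b) φ) (hψ : IsFlowOn w A S (Icc a b) ψ)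
    (hinit : ∀ x, |w (φ a) x - w (ψ a) x| ≤ m) {t : ℝ} (ht : t ∈ Icc a b) (x : X) :
    |w (φ t) x - w (ψ t) x| ≤ m := by
  simpa using abs_le_add_mul_of_abs_deriv_le_at_extr (f := fun y s => w (φ s) y - w (ψ s) y)
    (K := 0) (hφ.continuousOn.sub hψ.continuousOn)
    (fun s hs y => (hφ.hasDerivWithinAt s hs y).fun_sub (hψ.hasDerivWithinAt s hs y)) hinit
    (fun s hs y hy => sub_nonpos.mpr (hA _ (hφ.mem s hs) _ (hψ.mem s hs) y hy))
    (fun s hs y hy => by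
      rw [neg_zero, sub_nonneg]
      refine hA _ (hψ.mem s hs) _ (hφ.mem s hs) y ?_
      simpa only [neg_sub] using hy.neg) ht x

theorem IsDegenerateElliptic.abs_sub_initial_le (hA : IsDegenerateElliptic w A S)
    (hφ : IsFlowOn w A S (Icc a b) φ) (hK : ∀ x, |A (φ a) x| ≤ K) {t : ℝ} (ht : t ∈ Icc a b)
    (x : X) : |w (φ t) x - w (φ a) x| ≤ K * (t - a) := by
  have ha : a ∈ Icc a b := left_mem_Icc.mpr (ht.1.trans ht.2)
  have hcont : ContinuousOn (fun p : X × ℝ => w (φ a) p.1) (univ ×ˢ Icc a b) :=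
    hφ.continuousOn.comp (f := fun p : X × ℝ => (p.1, a)) (by fun_prop)
      fun p _ => ⟨mem_univ _, ha⟩
  simpa using abs_le_add_mul_of_abs_deriv_le_at_extr (f := fun y s => w (φ s) y - w (φ a) y)
    (m := 0) (hφ.continuousOn.sub hcont)
    (fun s hs y => (hφ.hasDerivWithinAt s hs y).sub_const _) (by simp)
    (fun s hs y hy => (hA _ (hφ.mem s hs) _ (hφ.mem a ha) y hy).trans (abs_le.mp (hK y)).2)
    (fun s hs y hy => (abs_le.mp (hK y)).1.trans <|
      hA _ (hφ.mem a ha) _ (hφ.mem s hs) y (by simpa only [neg_sub] using hy.neg)) ht x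

theorem IsDegenerateElliptic.abs_sub_le_mul_sub (hA : IsDegenerateElliptic w A S)
    (hφ : IsFlowOn w A S (Icc a b) φ) (hK : ∀ x, |A (φ a) x| ≤ K) {s t : ℝ} (has : a ≤ s)
    (hst : s ≤ t) (htb : t ≤ b) (x : X) : |w (φ t) x - w (φ s) x| ≤ K * (t - s) := by
  have hshift : IsFlowOn w A S (Icc a s) (fun r => φ (r + (t - s))) :=
    hφ.comp_add_const fun r hr => ⟨by linarith [hr.1], by linarith [hr.2]⟩
  have hinit : ∀ y, |w (φ (a + (t - s))) y - w (φ a) y| ≤ K * (t - s) := fun y => by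
    simpa using hA.abs_sub_initial_le hφ hK (t := a + (t - s))
      ⟨by linarith, by linarith⟩ y
  simpa using hA.abs_sub_le_of_abs_sub_le hshift
    (hφ.mono (Icc_subset_Icc_right (hst.trans htb))) hinit (right_mem_Icc.mpr has) x

theorem IsDegenerateElliptic.abs_speed_le (hA : IsDegenerateElliptic w A S)
    (hφ : IsFlowOn w A S (Icc a b) φ) (hK : ∀ x, |A (φ a) x| ≤ K) {t : ℝ} (ht : t ∈ Icc a b)
    (x : X) : |A (φ t) x| ≤ K := by
  rcases ht.1.eq_or_lt with rfl | hat
  · exact hK x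
  have hderiv := (hφ.hasDerivWithinAt t ht x).mono (Icc_subset_Icc_right ht.2)
  refine abs_le_of_hasDerivWithinAt_of_forall_abs_sub_le hderiv
    (uniqueDiffOn_Icc hat t (right_mem_Icc.mpr hat.le)) fun s hs => ?_
  rw [abs_sub_comm, abs_sub_comm s, abs_of_nonneg (sub_nonneg.mpr hs.2)]
  exact hA.abs_sub_le_mul_sub hφ hK hs.1 hs.2 ht.2 x

end DegenerateEllipticFlow

section TimeDerivative

open Set Filter Topology

variable {E G : Type*} [NormedAddCommGroup E] [NormedSpace ℝ E]
  [NormedAddCommGroup G] [NormedSpace ℝ G] {I : Set ℝ} {t : ℝ}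

theorem continuousAt_of_hasDerivWithinAt_of_contDiffWithinAt {u : E × ℝ → G} {d : E → G} {z : E}
    (hu : ContDiffWithinAt ℝ 1 u (univ ×ˢ I) (z, t)) (hI : UniqueDiffOn ℝ I) (ht : t ∈ I)
    (hd : ∀ y, HasDerivWithinAt (fun s => u (y, s)) (d y) I t) : ContinuousAt d z := by
  have hunique : UniqueDiffOn ℝ ((univ : Set E) ×ˢ I) := uniqueDiffOn_univ.prod hI
  have hslice : Tendsto (fun y : E => (y, t)) (𝓝 z) (𝓝[univ ×ˢ I] (z, t)) :=
    tendsto_nhdsWithin_iff.mpr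
      ⟨Continuous.tendsto (by fun_prop) z, .of_forall fun _ => ⟨trivial, ht⟩⟩
  have hfderiv : ContinuousAt (fun y => fderivWithin ℝ u (univ ×ˢ I) (y, t) (0, 1)) z :=
    ContinuousAt.clm_apply ((hu.continuousWithinAt_fderivWithin hunique one_ne_zero
      ⟨trivial, ht⟩).tendsto.comp hslice) continuousAt_const
  refine hfderiv.congr ?_
  have hnear := hu.eventually (by simp)
  rw [insert_eq_of_mem (show (z, t) ∈ univ ×ˢ I from ⟨trivial, ht⟩)] at hnear
  filter_upwards [hslice.eventually hnear] with y hy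
  have hline : HasDerivWithinAt (fun s : ℝ => (y, s)) ((0 : E), (1 : ℝ)) I t :=
    (hasDerivWithinAt_const t I y).prodMk (hasDerivWithinAt_id t I)
  have hchain := (hy.differentiableWithinAt one_ne_zero).hasFDerivWithinAt.comp_hasDerivWithinAt t
    hline fun s hs => ⟨trivial, hs⟩
  exact (hI t ht).eq_deriv _ hchain (hd y)

theorem continuous_of_hasDerivWithinAt_of_contMDiffOn {X : Type*} [TopologicalSpace X]
    [ChartedSpace E X] {u : X × ℝ → G} {d : X → G}
    (hu : ContMDiffOn (𝓘(ℝ, E).prod 𝓘(ℝ, ℝ)) 𝓘(ℝ, G) 1 u (univ ×ˢ I)) (hI : UniqueDiffOn ℝ I)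
    (ht : t ∈ I) (hd : ∀ x, HasDerivWithinAt (fun s => u (x, s)) (d x) I t) : Continuous d := by
  refine continuous_iff_continuousAt.mpr fun x => ?_
  have hchart : ContDiffWithinAt ℝ 1 (fun q : E × ℝ => u ((chartAt E x).symm q.1, q.2))
      (univ ×ˢ I) (chartAt E x x, t) := by
    have := (contMDiffWithinAt_iff.mp (hu (x, t) ⟨trivial, ht⟩)).2
    rw [(𝓘(ℝ, E).prod 𝓘(ℝ, ℝ)).range_eq_univ, inter_univ] at this
    exact this
  have hcont : ContinuousAt (d ∘ (chartAt E x).symm) (chartAt E x x) :=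
    continuousAt_of_hasDerivWithinAt_of_contDiffWithinAt hchart hI ht
      fun z => hd ((chartAt E x).symm z)
  refine (hcont.comp ((chartAt E x).continuousAt (mem_chart_source E x))).congr ?_
  filter_upwards [chart_source_mem_nhds E x] with y hy
  rw [Function.comp_apply, Function.comp_apply, (chartAt E x).left_inv hy]

end TimeDerivative

section LineMetric

open Filter Topology

variable {E : Type*} [NormedAddCommGroup E] [NormedSpace ℂ E]
  {X : Type*} [TopologicalSpace X] [ChartedSpace E X]
  {L : X → Type*} [∀ x, AddCommGroup (L x)] [∀ x, Module ℂ (L x)]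
  [TopologicalSpace (Bundle.TotalSpace ℂ L)]
  {e e' : Bundle.Trivialization ℂ (Bundle.TotalSpace.proj : Bundle.TotalSpace ℂ L → X)} {x : X}

theorem exists_eq_smul_frame [e.IsLinear ℂ] (hx : x ∈ e.baseSet) (v : L x) :
    ∃ c : ℂ, v = c • e.symm x 1 := by
  refine ⟨e.linearMapAt ℂ x v, ?_⟩
  rw [← e.symmₗ_apply (R := ℂ) hx, ← map_smul, smul_eq_mul, mul_one, e.symmₗ_linearMapAt hx]

theorem frame_ne_zero [e.IsLinear ℂ] (hx : x ∈ e.baseSet) : e.symm x 1 ≠ 0 := by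
  intro hzero
  have hone := e.linearMapAt_symmₗ (R := ℂ) hx 1
  rw [e.symmₗ_apply (R := ℂ) hx, hzero, map_zero] at hone
  exact zero_ne_one hone

variable [∀ x, TopologicalSpace (L x)] [FiberBundle ℂ L]

theorem LineMetric.diff_eq_diff_sub_diff (φ ψ χ : LineMetric E L) (x : X) :
    φ.diff ψ x = φ.diff χ x - ψ.diff χ x := by
  rw [diff, diff, diff, sub_sub_sub_cancel_right]

theorem LineMetric.diff_self (φ : LineMetric E L) (x : X) : φ.diff φ x = 0 :=
  sub_self _

variable [VectorBundle ℂ ℂ L] [MemTrivializationAtlas e] [MemTrivializationAtlas e']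
  {φ ψ : LineMetric E L}

theorem LineMetric.normSq_frame_pos (φ : LineMetric E L) (hx : x ∈ e.baseSet) :
    0 < φ.normSq x (e.symm x 1) :=
  φ.pos _ _ (frame_ne_zero hx)

theorem LineMetric.exists_weight_eq_add (hx : x ∈ e.baseSet) (hx' : x ∈ e'.baseSet) :
    ∃ r : ℝ, ∀ φ : LineMetric E L, φ.weight e x = r + φ.weight e' x := by
  obtain ⟨c, hc⟩ := exists_eq_smul_frame hx' (e.symm x 1)
  have hc0 : c ≠ 0 := by
    rintro rfl
    exact frame_ne_zero hx (by rw [hc, zero_smul])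
  refine ⟨-Real.log (‖c‖ ^ 2), fun φ => ?_⟩
  rw [weight, weight, hc, φ.smul, Real.log_mul (by simpa using hc0) (φ.normSq_frame_pos hx').ne',
    neg_add]

theorem LineMetric.diff_eq_weight_sub_weight (φ ψ : LineMetric E L) (hx : x ∈ e.baseSet) :
    φ.diff ψ x = φ.weight e x - ψ.weight e x := by
  obtain ⟨r, hr⟩ := exists_weight_eq_add (E := E)
    (FiberBundle.mem_baseSet_trivializationAt' (F := ℂ) (E := L) x) hx
  rw [diff, hr, hr, add_sub_add_left_eq_sub]

theorem LineMetric.eq_of_diff_eq_zero (h : ∀ x, φ.diff ψ x = 0) : φ = ψ := by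
  ext x v
  have hx := FiberBundle.mem_baseSet_trivializationAt' (F := ℂ) (E := L) x
  have hlog := h x
  rw [diff, weight, weight, neg_sub_neg, sub_eq_zero] at hlog
  obtain ⟨c, rfl⟩ := exists_eq_smul_frame hx v
  rw [φ.smul, ψ.smul,
    Real.log_injOn_pos (ψ.normSq_frame_pos hx) (φ.normSq_frame_pos hx) hlog]

theorem LineMetric.contMDiffOn_weight (φ : LineMetric E L)
    (e : Bundle.Trivialization ℂ (Bundle.TotalSpace.proj : Bundle.TotalSpace ℂ L → X))
    [MemTrivializationAtlas e] : ContMDiffOn 𝓘(ℝ, E) 𝓘(ℝ, ℝ) ∞ (φ.weight e) e.baseSet :=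
  (Real.contDiffOn_log.contMDiffOn.comp (φ.smooth e)
    fun _ hx => (φ.normSq_frame_pos hx).ne').neg

theorem LineMetric.contDiffAt_weight (φ : LineMetric E L) (hx : x ∈ e.baseSet) :
    ContDiffAt ℝ ∞ (fun z => φ.weight e ((chartAt E x).symm z)) (chartAt E x x) := by
  have hweight := (contMDiffAt_iff.mp
    ((φ.contMDiffOn_weight e).contMDiffAt (e.open_baseSet.mem_nhds hx))).2
  rw [modelWithCornersSelf_coe, Set.range_id, contDiffWithinAt_univ] at hweight
  exact hweight

/-- The curvature of a metric at a point as a bundled sesquilinear form. -/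
def LineMetric.curvatureForm (φ : LineMetric E L) (x : X) : E →ₗ[ℂ] E →ₗ⋆[ℂ] ℂ :=
  leviSesquilinear (fun z => φ.weight (trivializationAt ℂ L x) ((chartAt E x).symm z))
    (chartAt E x x)

theorem LineMetric.contDiffAt_two_weight (φ : LineMetric E L) (x : X) :
    ContDiffAt ℝ 2 (fun z => φ.weight (trivializationAt ℂ L x) ((chartAt E x).symm z))
      (chartAt E x x) :=
  (φ.contDiffAt_weight (FiberBundle.mem_baseSet_trivializationAt' x)).of_le
    (WithTop.coe_le_coe.mpr le_top)

theorem LineMetric.isHermitianForm_curvatureForm (φ : LineMetric E L) (x : X) :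
    IsHermitianForm (φ.curvatureForm x) :=
  isHermitianForm_leviSesquilinear (φ.contDiffAt_two_weight x)

theorem LineMetric.re_curvatureForm_self_le_of_isLocalMax_diff (h : IsLocalMax (φ.diff ψ) x)
    (u : E) : (φ.curvatureForm x u u).re ≤ (ψ.curvatureForm x u u).re := by
  refine re_leviForm_self_le_of_isLocalMax_sub (φ.contDiffAt_two_weight x)
    (ψ.contDiffAt_two_weight x) ?_ u
  have hx := FiberBundle.mem_baseSet_trivializationAt' (F := ℂ) (E := L) x
  have hleft := (chartAt E x).left_inv (mem_chart_source E x)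
  have hchart : Tendsto (chartAt E x).symm (𝓝 (chartAt E x x)) (𝓝 x) := by
    simpa only [ContinuousAt, hleft] using (chartAt E x).continuousAt_symm (mem_chart_target E x)
  filter_upwards [hchart.eventually ((trivializationAt ℂ L x).open_baseSet.mem_nhds hx),
    hchart.eventually h] with z hz hle
  simpa only [Pi.sub_apply, hleft, ← diff_eq_weight_sub_weight _ _ hz,
    ← diff_eq_weight_sub_weight _ _ hx] using hle

end LineMetric

section MetricFlow

open Set

variable {T : EReal} {t : ℝ}

theorem Icc_zero_subset_timeInterval (ht : t ∈ timeInterval T) : Icc 0 t ⊆ timeInterval T :=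
  fun _ hs => ⟨hs.1, (EReal.coe_le_coe_iff.mpr hs.2).trans_lt ht.2⟩

theorem zero_mem_timeInterval (ht : t ∈ timeInterval T) : 0 ∈ timeInterval T :=
  Icc_zero_subset_timeInterval ht (left_mem_Icc.mpr ht.1)

theorem uniqueDiffOn_timeInterval (T : EReal) : UniqueDiffOn ℝ (timeInterval T) := by
  rcases (timeInterval T).eq_empty_or_nonempty with hempty | ⟨t, ht⟩
  · rw [hempty]
    exact uniqueDiffOn_empty
  · obtain ⟨b, htb, hbT⟩ := EReal.lt_iff_exists_real_btwn.mp ht.2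
    have htb' : t < b := EReal.coe_lt_coe_iff.mp htb
    have hconvex : Convex ℝ (timeInterval T) := convex_iff_ordConnected.mpr
      ⟨fun r hr s hs _ hq => Icc_zero_subset_timeInterval hs ⟨hr.1.trans hq.1, hq.2⟩⟩
    refine uniqueDiffOn_convex hconvex ⟨(t + b) / 2, interior_mono
      (Icc_zero_subset_timeInterval ⟨ht.1.trans htb'.le, hbT⟩) ?_⟩
    rw [interior_Icc]
    exact ⟨by linarith [ht.1], by linarith⟩

variable {E : Type*} [NormedAddCommGroup E] [NormedSpace ℂ E]
  {X : Type*} [TopologicalSpace X] [ChartedSpace E X]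
  {L : X → Type*} [∀ x, AddCommGroup (L x)] [∀ x, Module ℂ (L x)]
  [∀ x, TopologicalSpace (L x)] [TopologicalSpace (Bundle.TotalSpace ℂ L)] [FiberBundle ℂ L]

/-- `φ` is a smooth solution on `X × [0, T)` of `∂φ/∂t = P φ`, `φ ∈ S`, `φ(0) = φ₀`, where `P` is an
arbitrary operator on metrics. `IsFlowSolution` is the case of the speed `tr_ω c(φ) - lam`. -/
structure IsSmoothSolution (P : LineMetric E L → X → ℝ) (S : Set (LineMetric E L))
    (φ₀ : LineMetric E L) (T : EReal) (φ : ℝ → LineMetric E L) : Prop where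
  smooth : ∀ (e : Bundle.Trivialization ℂ
      (Bundle.TotalSpace.proj : Bundle.TotalSpace ℂ L → X)) [MemTrivializationAtlas e],
    ContMDiffOn (𝓘(ℝ, E).prod 𝓘(ℝ, ℝ)) 𝓘(ℝ, ℝ) ∞
      (fun p : X × ℝ => (φ p.2).weight e p.1) (e.baseSet ×ˢ timeInterval T)
  mem : ∀ t ∈ timeInterval T, φ t ∈ S
  equation : ∀ t ∈ timeInterval T, ∀ x : X,
    HasDerivWithinAt (fun s => (φ s).weight (trivializationAt ℂ L x) x) (P (φ t) x)
      (timeInterval T) t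
  initial : φ 0 = φ₀

variable {P : LineMetric E L → X → ℝ} {S : Set (LineMetric E L)} {φ₀ : LineMetric E L}
  {φ : ℝ → LineMetric E L}

theorem IsSmoothSolution.hasDerivWithinAt_diff (hφ : IsSmoothSolution P S φ₀ T φ)
    (χ : LineMetric E L) (ht : t ∈ timeInterval T) (x : X) :
    HasDerivWithinAt (fun s => (φ s).diff χ x) (P (φ t) x) (timeInterval T) t :=
  (hφ.equation t ht x).sub_const _

variable [VectorBundle ℂ ℂ L]

theorem IsSmoothSolution.contMDiffOn_diff (hφ : IsSmoothSolution P S φ₀ T φ)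
    (χ : LineMetric E L) :
    ContMDiffOn (𝓘(ℝ, E).prod 𝓘(ℝ, ℝ)) 𝓘(ℝ, ℝ) ∞ (fun p : X × ℝ => (φ p.2).diff χ p.1)
      (univ ×ˢ timeInterval T) := by
  rintro ⟨x, t⟩ ⟨-, ht⟩
  let e := trivializationAt ℂ L x
  have hx : x ∈ e.baseSet := FiberBundle.mem_baseSet_trivializationAt' x
  have hlocal : ContMDiffOn (𝓘(ℝ, E).prod 𝓘(ℝ, ℝ)) 𝓘(ℝ, ℝ) ∞
      (fun p : X × ℝ => (φ p.2).diff χ p.1) (e.baseSet ×ˢ timeInterval T) :=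
    ((hφ.smooth e).sub ((χ.contMDiffOn_weight e).comp contMDiffOn_fst fun _ hp => hp.1)).congr
      fun p hp => (φ p.2).diff_eq_weight_sub_weight χ hp.1
  refine (hlocal (x, t) ⟨hx, ht⟩).mono_of_mem_nhdsWithin ?_
  rw [prod_eq, prod_eq, preimage_univ, univ_inter]
  exact Filter.inter_mem (mem_nhdsWithin_of_mem_nhds
    (continuous_fst.continuousAt.preimage_mem_nhds (e.open_baseSet.mem_nhds hx)))
    self_mem_nhdsWithin

theorem IsSmoothSolution.isFlowOn (hφ : IsSmoothSolution P S φ₀ T φ) (χ : LineMetric E L)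
    {I : Set ℝ} (hI : I ⊆ timeInterval T) : IsFlowOn (fun φ => φ.diff χ) P S I φ :=
  IsFlowOn.mono ⟨(hφ.contMDiffOn_diff χ).continuousOn, hφ.mem,
    fun _ ht => hφ.hasDerivWithinAt_diff χ ht⟩ hI

theorem IsSmoothSolution.continuous_speed (hφ : IsSmoothSolution P S φ₀ T φ)
    (ht : t ∈ timeInterval T) : Continuous (P (φ t)) :=
  continuous_of_hasDerivWithinAt_of_contMDiffOn
    ((hφ.contMDiffOn_diff φ₀).of_le (WithTop.coe_le_coe.mpr le_top)) (uniqueDiffOn_timeInterval T)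
    ht (hφ.hasDerivWithinAt_diff φ₀ ht)

variable [CompactSpace X]

theorem IsSmoothSolution.bddAbove_abs_initial_speed
    (hφ : IsSmoothSolution P S φ₀ T φ) (ht : t ∈ timeInterval T) :
    BddAbove (range fun x => |P φ₀ x|) := by
  have hcont := hφ.continuous_speed (zero_mem_timeInterval ht)
  rw [hφ.initial] at hcont
  exact isCompact_univ.bddAbove_image hcont.abs.continuousOn |>.mono image_univ.ge

theorem IsSmoothSolution.abs_initial_speed_le_iSup (hφ : IsSmoothSolution P S φ₀ T φ)
    (ht : t ∈ timeInterval T) (x : X) : |P (φ 0) x| ≤ ⨆ y, |P φ₀ y| := by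
  rw [hφ.initial]
  exact le_ciSup (hφ.bddAbove_abs_initial_speed ht) x

theorem IsSmoothSolution.eq_of_isDegenerateElliptic {T₁ T₂ : EReal} {ψ : ℝ → LineMetric E L}
    (hP : IsDegenerateElliptic (fun φ => φ.diff φ₀) P S) (hφ : IsSmoothSolution P S φ₀ T₁ φ)
    (hψ : IsSmoothSolution P S φ₀ T₂ ψ) (ht : t ∈ timeInterval T₁ ∩ timeInterval T₂) :
    φ t = ψ t := by
  refine LineMetric.eq_of_diff_eq_zero fun x => ?_
  rw [LineMetric.diff_eq_diff_sub_diff _ _ φ₀, ← abs_nonpos_iff]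
  refine hP.abs_sub_le_of_abs_sub_le (hφ.isFlowOn φ₀ (Icc_zero_subset_timeInterval ht.1))
    (hψ.isFlowOn φ₀ (Icc_zero_subset_timeInterval ht.2)) (fun y => ?_)
    (right_mem_Icc.mpr ht.1.1) x
  rw [hφ.initial, hψ.initial, sub_self, abs_zero]

theorem IsSmoothSolution.abs_speed_le_iSup (hP : IsDegenerateElliptic (fun φ => φ.diff φ₀) P S)
    (hφ : IsSmoothSolution P S φ₀ T φ) (ht : t ∈ timeInterval T) (x : X) :
    |P (φ t) x| ≤ ⨆ y, |P φ₀ y| :=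
  hP.abs_speed_le (hφ.isFlowOn φ₀ (Icc_zero_subset_timeInterval ht))
    (hφ.abs_initial_speed_le_iSup ht) (right_mem_Icc.mpr ht.1) x

theorem IsSmoothSolution.abs_diff_le_iSup_mul (hP : IsDegenerateElliptic (fun φ => φ.diff φ₀) P S)
    (hφ : IsSmoothSolution P S φ₀ T φ) (ht : t ∈ timeInterval T) (x : X) :
    |(φ t).diff φ₀ x| ≤ (⨆ y, |P φ₀ y|) * t := by
  simpa only [hφ.initial, LineMetric.diff_self, sub_zero] using
    hP.abs_sub_initial_le (hφ.isFlowOn φ₀ (Icc_zero_subset_timeInterval ht))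
      (hφ.abs_initial_speed_le_iSup ht) (right_mem_Icc.mpr ht.1) x

end MetricFlow

section GeodesicCurvature

open Set Filter
open scoped ComplexOrder

variable {E F : Type*} [NormedAddCommGroup E] [NormedSpace ℂ E] [FiniteDimensional ℂ E]
  [NormedAddCommGroup F] [NormedSpace ℂ F]
  {X M : Type*} [TopologicalSpace X] [ChartedSpace E X] [TopologicalSpace M] [ChartedSpace F M]
  {L : X → Type*} [∀ x, AddCommGroup (L x)] [∀ x, Module ℂ (L x)]
  [∀ x, TopologicalSpace (L x)] [TopologicalSpace (Bundle.TotalSpace ℂ L)] [FiberBundle ℂ L]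

theorem geodesicCurvature_eq_schurComplement (π : X → M) (φ : LineMetric E L) (x : X) (u w : E) :
    geodesicCurvature (F := F) π φ x u w =
      schurComplement (φ.curvatureForm x) (Module.finBasis ℂ (vertical (F := F) π x)) u w := by
  rw [schurComplement_apply]
  rfl

variable [FiniteDimensional ℂ F]

/-- The trace `tr_h c(φ)` of the geodesic curvature with respect to an arbitrary field `h` of
sesquilinear forms on the tangent spaces of the base. As in `trGeodesicCurvature`, of which this is
the version for metrics that need not be Kähler, the lifts of the basis vectors of the tangent space
are chosen by `Function.invFun`. -/
def geodesicCurvatureTrace (π : X → M)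
    (h : ∀ y : M, TangentSpace 𝓘(ℂ, F) y →ₗ[ℂ] TangentSpace 𝓘(ℂ, F) y →ₗ⋆[ℂ] ℂ)
    (φ : LineMetric E L) (x : X) : ℝ :=
  let e := Module.finBasis ℂ F
  ((gramMatrix (h (π x)) e)⁻¹ * Matrix.of fun α β => geodesicCurvature (F := F) π φ x
    (Function.invFun (differential (F := F) π x) (e α))
    (Function.invFun (differential (F := F) π x) (e β))).trace.re

theorem trGeodesicCurvature_eq_geodesicCurvatureTrace [IsManifold 𝓘(ℂ, F) ω M] (π : X → M)
    (g : KahlerMetric F M) (φ : LineMetric E L) (x : X) :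
    trGeodesicCurvature π g φ x = geodesicCurvatureTrace π g.form φ x := by
  simp only [trGeodesicCurvature, geodesicCurvatureTrace, Matrix.trace, Matrix.diag_apply,
    Matrix.mul_apply, Matrix.of_apply]
  rw [Finset.sum_comm]
  rfl

variable {π : X → M} {h : ∀ y : M, TangentSpace 𝓘(ℂ, F) y →ₗ[ℂ] TangentSpace 𝓘(ℂ, F) y →ₗ⋆[ℂ] ℂ}

theorem geodesicCurvatureTrace_le_of_isLocalMax_diff [VectorBundle ℂ ℂ L] {φ ψ : LineMetric E L}
    (hφ : φ ∈ FPlus (F := F) π) (hψ : ψ ∈ FPlus (F := F) π) {x : X}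
    (hh : IsHermitianForm (h (π x))) (hpos : IsPositiveOn (h (π x)) ⊤)
    (hmax : IsLocalMax (φ.diff ψ) x) :
    geodesicCurvatureTrace π h φ x ≤ geodesicCurvatureTrace π h ψ x := by
  have hG : (gramMatrix (h (π x)) (Module.finBasis ℂ F)).PosDef :=
    hh.posDef_gramMatrix (Module.finBasis ℂ F).linearIndependent fun u _ => hpos u trivial
  have hφ' : IsPositiveOn (φ.curvatureForm x) (vertical (F := F) π x) := hφ x
  have hψ' : IsPositiveOn (ψ.curvatureForm x) (vertical (F := F) π x) := hψ x
  have hφH := φ.isHermitianForm_curvatureForm x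
  have hψH := ψ.isHermitianForm_curvatureForm x
  simp only [geodesicCurvatureTrace, geodesicCurvature_eq_schurComplement]
  exact re_trace_mul_gramMatrix_mono
    (hφH.isHermitianForm_schurComplement (hφH.posDef_gramMatrix_basis hφ' _).isUnit)
    (hψH.isHermitianForm_schurComplement (hψH.posDef_gramMatrix_basis hψ' _).isUnit)
    (re_schurComplement_self_mono hφH hψH hφ' hψ'
      (LineMetric.re_curvatureForm_self_le_of_isLocalMax_diff hmax))
    hG.inv.posSemidef fun α => Function.invFun (differential (F := F) π x) (Module.finBasis ℂ F α)

theorem isDegenerateElliptic_geodesicCurvatureTrace_sub [VectorBundle ℂ ℂ L]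
    (hh : ∀ y, IsHermitianForm (h y)) (hpos : ∀ y, IsPositiveOn (h y) ⊤) (lam : ℝ)
    (χ : LineMetric E L) :
    IsDegenerateElliptic (fun φ : LineMetric E L => φ.diff χ)
      (fun φ x => geodesicCurvatureTrace π h φ x - lam) (FPlus (F := F) π) := by
  intro φ hφ ψ hψ x hmax
  have hdiff : IsLocalMax (φ.diff ψ) x := by
    rw [funext fun y => φ.diff_eq_diff_sub_diff ψ χ y]
    exact hmax.isLocalMax univ_mem
  exact sub_le_sub_right
    (geodesicCurvatureTrace_le_of_isLocalMax_diff hφ hψ (hh _) (hpos _) hdiff) lam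

theorem isFlowSolution_iff_isSmoothSolution [IsManifold 𝓘(ℂ, F) ω M] {g : KahlerMetric F M}
    {lam : ℝ} {φ₀ : LineMetric E L} {T : EReal} {φ : ℝ → LineMetric E L} :
    IsFlowSolution π g lam φ₀ T φ ↔
      IsSmoothSolution (fun φ x => geodesicCurvatureTrace π g.form φ x - lam)
        (FPlus (F := F) π) φ₀ T φ := by
  simp only [← trGeodesicCurvature_eq_geodesicCurvatureTrace]
  exact ⟨fun ⟨hsmooth, hmem, heq, hinit⟩ => ⟨hsmooth, hmem, heq, hinit⟩,
    fun ⟨hsmooth, hmem, heq, hinit⟩ => ⟨hsmooth, hmem, heq, hinit⟩⟩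

end GeodesicCurvature

end GeodesicFlow

end

theorem mainTheorem9_general
    {E F : Type*} [NormedAddCommGroup E] [NormedSpace ℂ E] [FiniteDimensional ℂ E]
    [NormedAddCommGroup F] [NormedSpace ℂ F] [FiniteDimensional ℂ F]
    {X M : Type*} [TopologicalSpace X] [ChartedSpace E X] [IsManifold 𝓘(ℂ, E) ω X]
    [TopologicalSpace M] [ChartedSpace F M] [IsManifold 𝓘(ℂ, F) ω M] [CompactSpace M]
    (π : X → M) (hπ : GeodesicFlow.IsHolomorphicFibration E F π)
    (L : X → Type*) [∀ x, AddCommGroup (L x)] [∀ x, Module ℂ (L x)]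
    [∀ x, TopologicalSpace (L x)] [TopologicalSpace (Bundle.TotalSpace ℂ L)]
    [FiberBundle ℂ L] [VectorBundle ℂ ℂ L] [ContMDiffVectorBundle ω ℂ L 𝓘(ℂ, E)]
    (h : ∀ y : M, TangentSpace 𝓘(ℂ, F) y →ₗ[ℂ] TangentSpace 𝓘(ℂ, F) y →ₗ⋆[ℂ] ℂ)
    (hh : ∀ y, GeodesicFlow.IsHermitianForm (h y)) (hpos : ∀ y, GeodesicFlow.IsPositiveOn (h y) ⊤)
    (lam : ℝ) (φ₀ : GeodesicFlow.LineMetric E L) :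
    (∀ (T₁ T₂ : EReal) (φ ψ : ℝ → GeodesicFlow.LineMetric E L),
      GeodesicFlow.IsSmoothSolution (fun φ x => GeodesicFlow.geodesicCurvatureTrace π h φ x - lam)
        (GeodesicFlow.FPlus (F := F) π) φ₀ T₁ φ →
      GeodesicFlow.IsSmoothSolution (fun φ x => GeodesicFlow.geodesicCurvatureTrace π h φ x - lam)
        (GeodesicFlow.FPlus (F := F) π) φ₀ T₂ ψ →
      ∀ t ∈ GeodesicFlow.timeInterval T₁ ∩ GeodesicFlow.timeInterval T₂, φ t = ψ t) ∧
    (∃ C : ℝ, 0 < C ∧ ∀ (T : EReal) (φ : ℝ → GeodesicFlow.LineMetric E L),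
      GeodesicFlow.IsSmoothSolution (fun φ x => GeodesicFlow.geodesicCurvatureTrace π h φ x - lam)
        (GeodesicFlow.FPlus (F := F) π) φ₀ T φ →
      ∀ t ∈ GeodesicFlow.timeInterval T, ∀ x : X,
        |GeodesicFlow.geodesicCurvatureTrace π h (φ t) x| < C ∧ |(φ t).diff φ₀ x| ≤ C * t) := by
  have : CompactSpace X := ⟨hπ.proper.isCompact_preimage isCompact_univ⟩
  have hP := GeodesicFlow.isDegenerateElliptic_geodesicCurvatureTrace_sub (π := π) hh hpos lam φ₀
  refine ⟨fun T₁ T₂ φ ψ hφ hψ t ht => hφ.eq_of_isDegenerateElliptic hP hψ ht, ?_⟩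
  set K : ℝ := ⨆ y, |GeodesicFlow.geodesicCurvatureTrace π h φ₀ y - lam|
  have hK : 0 ≤ K := Real.iSup_nonneg fun _ => abs_nonneg _
  refine ⟨K + |lam| + 1, by positivity, fun T φ hφ t ht x => ⟨?_, ?_⟩⟩
  · have hspeed := hφ.abs_speed_le_iSup hP ht x
    have htriangle := abs_add_le (GeodesicFlow.geodesicCurvatureTrace π h (φ t) x - lam) lam
    rw [sub_add_cancel] at htriangle
    linarith
  · refine (hφ.abs_diff_le_iSup_mul hP ht x).trans (mul_le_mul_of_nonneg_right ?_ ht.1)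
    linarith [abs_nonneg lam]

theorem mainTheorem9
    {E F : Type*} [NormedAddCommGroup E] [NormedSpace ℂ E] [FiniteDimensional ℂ E]
    [NormedAddCommGroup F] [NormedSpace ℂ F] [FiniteDimensional ℂ F]
    {X M : Type*}
    [TopologicalSpace X] [T2Space X] [ChartedSpace E X] [IsManifold 𝓘(ℂ, E) ω X]
    [TopologicalSpace M] [T2Space M] [ChartedSpace F M] [IsManifold 𝓘(ℂ, F) ω M]
    [CompactSpace M]
    (π : X → M) (hπ : GeodesicFlow.IsHolomorphicFibration E F π)
    (L : X → Type*) [∀ x, AddCommGroup (L x)] [∀ x, Module ℂ (L x)]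
    [∀ x, TopologicalSpace (L x)] [TopologicalSpace (Bundle.TotalSpace ℂ L)]
    [FiberBundle ℂ L] [VectorBundle ℂ ℂ L] [ContMDiffVectorBundle ω ℂ L 𝓘(ℂ, E)]
    (g : GeodesicFlow.KahlerMetric F M) (lam : ℝ)
    (φ₀ : GeodesicFlow.LineMetric E L) (hφ₀ : φ₀ ∈ GeodesicFlow.FPlus (F := F) π) :
    (∀ (T₁ T₂ : EReal) (φ ψ : ℝ → GeodesicFlow.LineMetric E L),
      GeodesicFlow.IsFlowSolution π g lam φ₀ T₁ φ →
      GeodesicFlow.IsFlowSolution π g lam φ₀ T₂ ψ →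
      ∀ t ∈ GeodesicFlow.timeInterval T₁ ∩ GeodesicFlow.timeInterval T₂, φ t = ψ t) ∧
    (∃ C : ℝ, 0 < C ∧ ∀ (T : EReal) (φ : ℝ → GeodesicFlow.LineMetric E L),
      GeodesicFlow.IsFlowSolution π g lam φ₀ T φ →
      ∀ t ∈ GeodesicFlow.timeInterval T, ∀ x : X,
        |GeodesicFlow.trGeodesicCurvature π g (φ t) x| < C ∧
        |(φ t).diff φ₀ x| ≤ C * t) := by
  simpa only [GeodesicFlow.isFlowSolution_iff_isSmoothSolution,
    GeodesicFlow.trGeodesicCurvature_eq_geodesicCurvatureTrace] using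
    mainTheorem9_general π hπ L g.form g.hermitian (fun y a _ => g.pos y a) lam φ₀
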